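/- Let $\mathbb{F}_q$ be a finite field, $\theta\in\mathrm{Aut}(\mathbb{F}_q)$, and $R=\mathbb{F}_q[X;\theta]$ the skew polynomial ring, in which $X\cdot c=\theta(c)X$ for $c\in\mathbb{F}_q$. Vectors are row vectors, maps act on the right, $A_t$ is the transpose of a matrix $A$, and for a square matrix $A$ the $\theta$-semi-linear map $\Theta\circ A$ sends $\vec v$ to $(\vec v\,\Theta)A$, where $\Theta$ applies $\theta$ to every coordinate. Let $n_1,\dots,n_r\ge 1$, $n=\sum_j n_j$, and identify $\mathbb{F}_q^n=\mathbb{F}_q^{n_1}\times\dots\times\mathbb{F}_q^{n_r}$. For $j=1,\dots,r$ let $a_{j,0},\dots,a_{j,n_j-1}\in\mathbb{F}_q$ with $a_{j,0}\neq 0$, let $M_j$ be the $n_j\times n_j$ matrix with ones just above the diagonal, last row $(a_{j,0},\dots,a_{j,n_j-1})$ and zeros elsewhere, and put $f_j=(-1)^{n_j}\bigl(X^{n_j}-\sum_{i=0}^{n_j-1}a_{j,i}X^i\bigr)\in R$. Let $T=\Theta\circ M$ be a $\theta$-semi-linear map of $\mathbb{F}_q^n$ and $C$ an invertible matrix with $T=C^{-1}DC$,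 where $D=\Theta\circ\mathrm{diag}(M_1,\dots,M_r)$. A linear code $\mathcal{C}\subseteq\mathbb{F}_q^n$ is a $T$-code if it is invariant under $T$. A linear code $\mathcal{C}_j\subseteq\mathbb{F}_q^{n_j}$ is an $f_j$-module $\theta$-code if its image under $(c_0,\dots,c_{n_j-1})\mapsto\sum_i c_iX^i+Rf_j$ is the left submodule $Rg_j/Rf_j$ of $R/Rf_j$ for some right divisor $g_j$ of $f_j$. A product $T$-code is a $T$-code of the form $(\mathcal{C}_1\times\dots\times\mathcal{C}_r)C$ with every $\mathcal{C}_j\subseteq\mathbb{F}_q^{n_j}$ an $f_j$-module $\theta$-code. For each $j$ let $m_j$ be the least integer $m\ge n_j$ such that $X^{m}-1=f_jp$ for some $p\in R$ (it exists), and let $q_{f_j}\in R$ be the skew polynomial with $X^{m_j}-1=f_jq_{f_j}$, regarded also as the vector $\vec q_{f_j}\in\mathbb{F}_q^{m_j}$ of its coefficients, padded with zeros. Let $P_j$ be the $m_j\times m_j$ matrix with ones just above the diagonal, last row $(1,0,\dots,0)$ and zeros elsewhere, let $Q_j$ be the $n_j\times m_j$ matrix with rows $\vec q_{f_j}(\Theta\circ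 P_j)^k$, $k=0,\dots,n_j-1$, and put $\widehat Q=\mathrm{diag}(Q_1,\dots,Q_r)$ and $$B=C^{-1}\,\widehat Q\,\widehat Q_t\,(C^{-1})_t .$$ Put $\mathrm{Ker}\,B=\{\vec x\in\mathbb{F}_q^n : \vec xB=\vec 0\}$, and for a linear code $\mathcal{C}$ let $\mathcal{C}^*=\{\vec x\in\mathbb{F}_q^n : \vec xB\,\vec c_t=0\ \text{for all}\ \vec c\in\mathcal{C}\}$ be its quasi-Euclidean dual code. Assume $(\diamond\diamond)$: the order of $\theta$ divides $m_j$ for every $j=1,\dots,r$. Let $\mathcal{C}$ be a product $T$-code. Then $$\mathcal{C}^*\ \text{is a product}\ T\text{-code}\iff \mathcal{C}+\mathrm{Ker}\,B\ \text{is a product}\ T\text{-code}.$$ -/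

import Mathlib

noncomputable section

namespace SemilinearCode

open Matrix

/-- The field `F`, remembering an automorphism `θ` of it, so that `Multiplicative ℕ` can act on it
through the powers of `θ`. -/
def Twisted {F : Type*} [Field F] (_θ : RingAut F) : Type _ := F

instance instFieldTwisted {F : Type*} [Field F] (θ : RingAut F) : Field (Twisted θ) :=
  inferInstanceAs (Field F)

instance instActionTwisted {F : Type*} [Field F] (θ : RingAut F) :
    MulSemiringAction (Multiplicative ℕ) (Twisted θ) :=
  MulSemiringAction.compHom F (powersHom (RingAut F) θ)

/-- The skew polynomial ring `R = F[X; θ]`, in which `X a = θ(a) X`. -/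
abbrev SkewRing {F : Type*} [Field F] (θ : RingAut F) : Type _ := SkewPolynomial (Twisted θ)

/-- `a ∈ F` as a coefficient of a skew polynomial. -/
def toTwisted {F : Type*} [Field F] (θ : RingAut F) (a : F) : Twisted θ := a

/-- The monomial `a X ^ i` of `R = F[X; θ]`. -/
def mono {F : Type*} [Field F] (θ : RingAut F) (i : ℕ) (a : F) : SkewRing θ :=
  SkewPolynomial.monomial i (toTwisted θ a)

/-- The indeterminate `X` of `R = F[X; θ]`. -/
def indet {F : Type*} [Field F] (θ : RingAut F) : SkewRing θ := SkewPolynomial.X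

/-- The coefficient of `X ^ i` in a skew polynomial, as an element of `F`. -/
def coeffOf {F : Type*} [Field F] {θ : RingAut F} (p : SkewRing θ) (i : ℕ) : F :=
  SkewPolynomial.coeff p i

/-- The commutation rule of `R`. -/
theorem indet_mul_const {F : Type*} [Field F] (θ : RingAut F) (a : F) :
    indet θ * mono θ 0 a = mono θ 0 (θ a) * indet θ := by
  have h : (SkewPolynomial.φ (toTwisted θ a) : Twisted θ) = toTwisted θ (θ a) := by
    change (powersHom (RingAut F) θ (Multiplicative.ofAdd 1)) a = θ a
    simp
  simp only [indet, mono, SkewPolynomial.X_mul_monomial, SkewPolynomial.monomial_mul_X, h]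

/-- The `θ`-semi-linear transformation `Θ ∘ A`, acting on row vectors on the right: first apply `θ`
to every coordinate, then multiply by the matrix `A`. -/
def semilin {F : Type*} [Field F] {ι : Type*} [Fintype ι] (θ : RingAut F) (A : Matrix ι ι F) :
    (ι → F) →ₛₗ[(θ : F →+* F)] (ι → F) where
  toFun v := (fun i => θ (v i)) ᵥ* A
  map_add' v w := by
    have : (fun i => θ ((v + w) i)) = (fun i => θ (v i)) + fun i => θ (w i) := by
      ext i; simp
    rw [this, Matrix.add_vecMul]
  map_smul' c v := by
    have : (fun i => θ ((c • v) i)) = θ c • fun i => θ (v i) := by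
      ext i; simp
    rw [this, Matrix.smul_vecMul]
    rfl

/-- The companion matrix with ones above the diagonal and last row `(a₀, …, a_{n-1})`. -/
def companion {F : Type*} [Field F] {n : ℕ} (a : Fin n → F) : Matrix (Fin n) (Fin n) F :=
  Matrix.of fun i k =>
    if (i : ℕ) + 1 = n then a k else if (k : ℕ) = i + 1 then 1 else 0

/-- The skew polynomial `f = (-1)ⁿ (Xⁿ - ∑ aᵢ Xⁱ)` attached to the companion matrix of `a`. -/
def skewChar {F : Type*} [Field F] (θ : RingAut F) {n : ℕ} (a : Fin n → F) : SkewRing θ :=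
  (-1) ^ n * (indet θ ^ n - ∑ i : Fin n, mono θ i (a i))

/-- The representation map `π : Fⁿ → R/Rf`, `(c₀, …, c_{n-1}) ↦ ∑ cᵢ Xⁱ + Rf`. Here
`Ideal.span {f}` is the left ideal `Rf` and the quotient is a left `R`-module. -/
def polyRep {F : Type*} [Field F] (θ : RingAut F) {n : ℕ} (f : SkewRing θ) (c : Fin n → F) :
    SkewRing θ ⧸ Ideal.span {f} :=
  Submodule.Quotient.mk (∑ i : Fin n, mono θ i (c i))

/-- A linear code `𝒞 ⊆ Fⁿ` is an `f`-module `θ`-code, where `f = skewChar θ a`, if its image in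
`R/Rf` is the left submodule `Rg/Rf` for some right divisor `g` of `f`. -/
def IsModuleCode {F : Type*} [Field F] (θ : RingAut F) {n : ℕ} (a : Fin n → F)
    (𝒞 : Submodule F (Fin n → F)) : Prop :=
  ∃ g : SkewRing θ, (∃ h : SkewRing θ, skewChar θ a = h * g) ∧
    polyRep θ (skewChar θ a) '' (𝒞 : Set (Fin n → F)) =
      (Submodule.map (Submodule.mkQ (Ideal.span {skewChar θ a})) (Ideal.span {g}) :
        Submodule (SkewRing θ) (SkewRing θ ⧸ Ideal.span {skewChar θ a}))

/-- A linear code is a `T`-code, `T = Θ ∘ M`, if it is invariant under `T`. -/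
def IsTCode {F : Type*} [Field F] {ι : Type*} [Fintype ι] (θ : RingAut F) (M : Matrix ι ι F)
    (𝒞 : Submodule F (ι → F)) : Prop :=
  ∀ v ∈ 𝒞, semilin θ M v ∈ 𝒞

/-- The product code `𝒞₁ × ⋯ × 𝒞ᵣ` in `F^{n₁} × ⋯ × F^{nᵣ}`, the latter being the space of row
vectors whose coordinates are indexed by the pairs `(j, k)` with `k < n j`. -/
def prodCode {F : Type*} [Field F] {r : ℕ} {n : Fin r → ℕ}
    (𝒞 : ∀ j, Submodule F (Fin (n j) → F)) : Submodule F ((Σ j, Fin (n j)) → F) :=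
  ⨅ j, (𝒞 j).comap (LinearMap.funLeft F F (Sigma.mk j))

/-- The standing hypothesis on the data: every `n j` is positive and every `a_{j,0}` is nonzero, `C` is an invertible
matrix, and `T = Θ ∘ M` is `θ`-similar by `C` to `D = Θ ∘ diag(M₁, …, Mᵣ)`, that is `T = C⁻¹ D C`
as maps acting on the right, where `M_j` is the companion matrix of `a j`. -/
structure HypStar {F : Type*} [Field F] (θ : RingAut F) {r : ℕ} (n : Fin r → ℕ)
    (a : ∀ j, Fin (n j) → F) (M C : Matrix (Σ j, Fin (n j)) (Σ j, Fin (n j)) F) : Prop where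
  pos : ∀ j, 0 < n j
  const_ne_zero : ∀ j, a j ⟨0, pos j⟩ ≠ 0
  invertible : IsUnit C
  similar : ∀ v, semilin θ M v =
    semilin θ (Matrix.blockDiagonal' fun j => companion (a j)) (v ᵥ* C⁻¹) ᵥ* C

/-- A product `T`-code: a `T`-code of the form `(𝒞₁ × ⋯ × 𝒞ᵣ) C` with every `𝒞_j` an `f_j`-module
`θ`-code, `f_j = skewChar θ (a j)`. -/
def IsProductTCode {F : Type*} [Field F] (θ : RingAut F) {r : ℕ} {n : Fin r → ℕ}
    (a : ∀ j, Fin (n j) → F) (M C : Matrix (Σ j, Fin (n j)) (Σ j, Fin (n j)) F)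
    (𝒞 : Submodule F ((Σ j, Fin (n j)) → F)) : Prop :=
  IsTCode θ M 𝒞 ∧
    ∃ 𝒟 : ∀ j, Submodule F (Fin (n j) → F),
      (∀ j, IsModuleCode θ (a j) (𝒟 j)) ∧ 𝒞 = (prodCode 𝒟).map C.vecMulLinear

/-- The least `m ≥ n` such that `X ^ m - 1 = f * p` for some `p`, where `f = skewChar θ a`.
(`f ∣ g` means `∃ p, g = f * p`. Such an `m` exists if `F` is finite and `a₀ ≠ 0`.) -/
def period {F : Type*} [Field F] (θ : RingAut F) {n : ℕ} (a : Fin n → F) : ℕ :=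
  sInf {m : ℕ | n ≤ m ∧ skewChar θ a ∣ indet θ ^ m - 1}

open Classical in
/-- The skew polynomial `q_f` with `X ^ m - 1 = f * q_f`, where `m = period θ a`. -/
def cofactor {F : Type*} [Field F] (θ : RingAut F) {n : ℕ} (a : Fin n → F) : SkewRing θ :=
  if h : ∃ q, indet θ ^ period θ a - 1 = skewChar θ a * q then h.choose else 0

/-- The matrix of the cyclic shift: ones above the diagonal and last row `(1, 0, …, 0)`. -/
def shiftMatrix (F : Type*) [Field F] (m : ℕ) : Matrix (Fin m) (Fin m) F :=
  companion fun k => if (k : ℕ) = 0 then 1 else 0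

/-- The `n × m` matrix `Q` with rows `q_f (Θ ∘ P)^k`, `k = 0, …, n - 1`. -/
def embMatrix {F : Type*} [Field F] (θ : RingAut F) {n : ℕ} (a : Fin n → F) :
    Matrix (Fin n) (Fin (period θ a)) F :=
  Matrix.of fun k =>
    (semilin θ (shiftMatrix F (period θ a)))^[(k : ℕ)] fun i => coeffOf (cofactor θ a) i

/-- The block diagonal matrix `Q̂ = diag(Q₁, …, Qᵣ)`. -/
def embBlock {F : Type*} [Field F] (θ : RingAut F) {r : ℕ} {n : Fin r → ℕ}
    (a : ∀ j, Fin (n j) → F) :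
    Matrix (Σ j, Fin (n j)) (Σ j, Fin (period θ (a j))) F :=
  Matrix.blockDiagonal' fun j => embMatrix θ (a j)

/-- The symmetric matrix `B = C⁻¹ Q̂ Q̂ᵗ (C⁻¹)ᵗ`. -/
def formMatrix {F : Type*} [Field F] (θ : RingAut F) {r : ℕ} {n : Fin r → ℕ}
    (a : ∀ j, Fin (n j) → F) (C : Matrix (Σ j, Fin (n j)) (Σ j, Fin (n j)) F) :
    Matrix (Σ j, Fin (n j)) (Σ j, Fin (n j)) F :=
  C⁻¹ * embBlock θ a * (embBlock θ a)ᵀ * (C⁻¹)ᵀ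

/-- The dual of a linear code for the product `x B yᵗ`. With `B = formMatrix θ a C` this is the
quasi-Euclidean dual code `𝒞*`. -/
def dualCode {F : Type*} [Field F] {ι : Type*} [Fintype ι] (B : Matrix ι ι F)
    (𝒞 : Submodule F (ι → F)) : Submodule F (ι → F) where
  carrier := {x | ∀ c ∈ 𝒞, (x ᵥ* B) ⬝ᵥ c = 0}
  add_mem' hx hy c hc := by
    rw [Matrix.add_vecMul, add_dotProduct, hx c hc, hy c hc, add_zero]
  zero_mem' c _ := by simp
  smul_mem' t x hx c hc := by
    rw [Matrix.smul_vecMul, smul_dotProduct, hx c hc, smul_zero]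

/-- `Ker B = {x | x B = 0}`. -/
def kerCode {F : Type*} [Field F] {ι : Type*} [Fintype ι] (B : Matrix ι ι F) :
    Submodule F (ι → F) :=
  LinearMap.ker B.vecMulLinear

end SemilinearCode

end

/-! For every product `T`-code both sides of the equivalence hold, and each is proved separately.
Two facts carry this. Since `Θ ∘ companion a` is left multiplication by `X` on `R/Rf`, and left
ideals of `R` are principal, the `f`-module codes are exactly the codes invariant under that map
(`isModuleCode_iff_isTCode`). Sums of module codes are then module codes. Right multiplication by
`q_f` maps `R/Rf` to `R/R(X ^ m - 1)`, so `Q` intertwines the companion map with the cyclic shift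
(`semilin_vecMul_embMatrix`). The shift matrix is orthogonal, hence the form `x Q Qᵗ yᵗ` is
preserved up to `θ`, and duals of invariant codes are invariant (`IsTCode.dualCode_of_intertwines`).
The kernel of the form is the dual of the whole space, so it is a module code too. Duals, kernels
and sums are computed block by block and transported by `C`, which gives the result for `B`. -/

noncomputable section

namespace SemilinearCode

open Matrix

/-! ### Coefficients, degrees and right division in `F[X; θ]`. -/

section SkewPolynomials

variable {F : Type*} [Field F] {θ : RingAut F}

/-- Extraction of a coefficient, as an additive homomorphism. -/
def coeffHom (θ : RingAut F) (i : ℕ) : SkewRing θ →+ F where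
  toFun p := coeffOf p i
  map_zero' := rfl
  map_add' p q := SkewPolynomial.coeff_add p q i

theorem coeffOf_add (p q : SkewRing θ) (i : ℕ) :
    coeffOf (p + q) i = coeffOf p i + coeffOf q i := (coeffHom θ i).map_add p q

theorem coeffOf_sub (p q : SkewRing θ) (i : ℕ) :
    coeffOf (p - q) i = coeffOf p i - coeffOf q i := (coeffHom θ i).map_sub p q

theorem coeffOf_neg (p : SkewRing θ) (i : ℕ) : coeffOf (-p) i = -coeffOf p i :=
  (coeffHom θ i).map_neg p

theorem coeffOf_sum {ι : Type*} (s : Finset ι) (p : ι → SkewRing θ) (i : ℕ) :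
    coeffOf (∑ k ∈ s, p k) i = ∑ k ∈ s, coeffOf (p k) i := map_sum (coeffHom θ i) p s

theorem coeffOf_mono (i k : ℕ) (a : F) : coeffOf (mono θ i a) k = if i = k then a else 0 :=
  SkewPolynomial.coeff_monomial

theorem ext_coeffOf {p q : SkewRing θ} (h : ∀ i, coeffOf p i = coeffOf q i) : p = q :=
  SkewMonoidAlgebra.ext fun i => h i.toAdd

theorem mono_add (i : ℕ) (a b : F) : mono θ i (a + b) = mono θ i a + mono θ i b :=
  SkewPolynomial.monomial_add ..

theorem mono_zero (i : ℕ) : mono θ i 0 = 0 := SkewPolynomial.monomial_zero_right i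

theorem mono_one (i : ℕ) : mono θ i 1 = indet θ ^ i :=
  SkewPolynomial.monomial_one_right_eq_X_pow i

theorem ofAdd_smul_toTwisted (i : ℕ) (a : F) :
    Multiplicative.ofAdd i • toTwisted θ a = toTwisted θ ((θ ^ i) a) := by
  change (powersHom (RingAut F) θ (Multiplicative.ofAdd i)) a = (θ ^ i) a
  simp

theorem mono_mul_mono (i k : ℕ) (a b : F) :
    mono θ i a * mono θ k b = mono θ (i + k) (a * (θ ^ i) b) := by
  simp only [mono, SkewPolynomial.monomial_mul_monomial, SkewPolynomial.φ_iterate_apply,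
    ofAdd_smul_toTwisted]
  rfl

theorem indet_mul_mono (k : ℕ) (b : F) : indet θ * mono θ k b = mono θ (k + 1) (θ b) := by
  rw [← pow_one (indet θ), ← mono_one, mono_mul_mono, one_mul, pow_one, add_comm]

theorem mono_eq_mul_indet_pow (i : ℕ) (a : F) : mono θ i a = mono θ 0 a * indet θ ^ i := by
  rw [← mono_one, mono_mul_mono]; simp

theorem induction_mono {P : SkewRing θ → Prop} (p : SkewRing θ) (h0 : P 0)
    (h : ∀ i a q, P q → P (mono θ i a + q)) : P p :=
  SkewPolynomial.induction p h0 fun i a q _ _ hq => h i a q hq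

theorem coeffOf_mono_mul (i : ℕ) (a : F) (q : SkewRing θ) (k : ℕ) :
    coeffOf (mono θ i a * q) k = if i ≤ k then a * (θ ^ i) (coeffOf q (k - i)) else 0 := by
  induction q using induction_mono with
  | h0 =>
    rw [mul_zero]
    change (0 : F) = if i ≤ k then a * (θ ^ i) 0 else 0
    simp
  | h l b q ih =>
    rw [mul_add, coeffOf_add, ih, mono_mul_mono, coeffOf_mono, coeffOf_add, coeffOf_mono]
    by_cases hik : i ≤ k
    · have : i + l = k ↔ l = k - i := by omega
      simp only [hik, if_true, this, map_add, mul_add]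
      congr 1
      split_ifs <;> simp
    · have : i + l ≠ k := by omega
      simp [hik, this]

/-- All the coefficients of `p` in degrees at least `N` vanish. -/
def DegLT (p : SkewRing θ) (N : ℕ) : Prop := ∀ i, N ≤ i → coeffOf p i = 0

theorem DegLT.sub {p q : SkewRing θ} {N : ℕ} (hp : DegLT p N) (hq : DegLT q N) :
    DegLT (p - q) N := fun i hi => by rw [coeffOf_sub, hp i hi, hq i hi, sub_zero]

theorem exists_degLT (p : SkewRing θ) : ∃ N, DegLT p N := by
  induction p using induction_mono with
  | h0 => exact ⟨0, fun _ _ => rfl⟩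
  | h i a q ih =>
    obtain ⟨N, hN⟩ := ih
    refine ⟨max (i + 1) N, fun k hk => ?_⟩
    rw [coeffOf_add, coeffOf_mono, hN k (by omega), if_neg (by omega), add_zero]

theorem DegLT.eq_sum {p : SkewRing θ} {N : ℕ} (hp : DegLT p N) :
    p = ∑ i : Fin N, mono θ i (coeffOf p i) := by
  apply ext_coeffOf
  intro k
  rw [coeffOf_sum]
  simp only [coeffOf_mono]
  rw [Fin.sum_univ_eq_sum_range (fun i => if i = k then coeffOf p i else 0) N]
  simp only [Finset.sum_ite_eq', Finset.mem_range]
  split_ifs with h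
  · rfl
  · exact hp k (by omega)

theorem exists_top_coeffOf {p : SkewRing θ} (hp : p ≠ 0) :
    ∃ d, coeffOf p d ≠ 0 ∧ DegLT p (d + 1) := by
  classical
  have hex := exists_degLT p
  have hN := Nat.find_spec hex
  have hmin := fun k => Nat.find_min (m := k) hex
  generalize Nat.find hex = N at hN hmin
  cases N with
  | zero => exact absurd (ext_coeffOf fun i => hN i (Nat.zero_le i)) hp
  | succ d =>
    refine ⟨d, fun h => hmin d (Nat.lt_succ_self d) fun i hi => ?_, hN⟩
    rcases hi.eq_or_lt with rfl | hi
    · exact h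
    · exact hN i hi

theorem coeffOf_mul {p q : SkewRing θ} {N : ℕ} (hp : DegLT p N) (k : ℕ) :
    coeffOf (p * q) k = ∑ i : Fin N,
      if (i : ℕ) ≤ k then coeffOf p i * (θ ^ (i : ℕ)) (coeffOf q (k - i)) else 0 := by
  conv_lhs => rw [hp.eq_sum, Finset.sum_mul, coeffOf_sum]
  simp only [coeffOf_mono_mul]

/-- Only the two leading terms meet in this degree. As `θ ^ N` is injective, degrees add for nonzero
factors. -/
theorem coeffOf_mul_top {p q : SkewRing θ} {N M : ℕ} (hp : DegLT p (N + 1))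
    (hq : DegLT q (M + 1)) :
    coeffOf (p * q) (N + M) = coeffOf p N * (θ ^ N) (coeffOf q M) := by
  rw [coeffOf_mul hp, Fin.sum_univ_castSucc, Finset.sum_eq_zero]
  · simp
  · intro i _
    rw [hq _ (by simp; omega)]
    simp

/-- Right division with remainder. -/
theorem exists_sub_mul_degLT {g : SkewRing θ} {d : ℕ} (hd : coeffOf g d ≠ 0)
    (hg : DegLT g (d + 1)) (p : SkewRing θ) : ∃ u, DegLT (p - u * g) d := by
  obtain ⟨N, hN⟩ := exists_degLT p
  induction N generalizing p with
  | zero => exact ⟨0, fun i _ => by rw [zero_mul, sub_zero]; exact hN i (Nat.zero_le i)⟩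
  | succ N ih =>
    by_cases hNd : N < d
    · exact ⟨0, fun i hi => by rw [zero_mul, sub_zero]; exact hN i (by omega)⟩
    · have hθ : (θ ^ (N - d)) (coeffOf g d) ≠ 0 := (map_ne_zero (θ ^ (N - d))).2 hd
      -- Moving `X ^ (N - d)` past the leading coefficient of `g` twists it by `θ ^ (N - d)`, hence
      -- this denominator.
      set u : SkewRing θ := mono θ (N - d) (coeffOf p N / (θ ^ (N - d)) (coeffOf g d)) with hu
      have hdeg : DegLT (p - u * g) N := by
        intro i hi
        rw [coeffOf_sub, hu, coeffOf_mono_mul, if_pos (by omega)]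
        rcases hi.eq_or_lt with rfl | hi
        · rw [show N - (N - d) = d by omega, div_mul_cancel₀ _ hθ, sub_self]
        · rw [hN i hi, hg (i - (N - d)) (by omega), map_zero, mul_zero, sub_zero]
      obtain ⟨v, hv⟩ := ih _ hdeg
      exact ⟨v + u, by rwa [add_mul, add_comm, ← sub_sub]⟩

/-- Every left ideal of `F[X; θ]` is principal. -/
theorem exists_eq_span_singleton (I : Ideal (SkewRing θ)) : ∃ g, I = Ideal.span {g} := by
  classical
  by_cases hI : ∃ d, ∃ g ∈ I, coeffOf g d ≠ 0 ∧ DegLT g (d + 1)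
  -- A generator is an element of least degree: a nonzero remainder modulo `g` would lie in `I` with
  -- smaller degree.
  · obtain ⟨g, hgI, hg0, hg⟩ := Nat.find_spec hI
    refine ⟨g, le_antisymm (fun p hp => ?_) ?_⟩
    · obtain ⟨u, hu⟩ := exists_sub_mul_degLT hg0 hg p
      have hr : p - u * g ∈ I := I.sub_mem hp (I.mul_mem_left u hgI)
      by_cases h0 : p - u * g = 0
      · rw [Ideal.mem_span_singleton', sub_eq_zero.1 h0]
        exact ⟨u, rfl⟩
      · obtain ⟨e, he0, he⟩ := exists_top_coeffOf h0
        have hlt : e < Nat.find hI := not_le.1 fun h => he0 (hu e h)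
        exact absurd ⟨_, hr, he0, he⟩ (Nat.find_min hI hlt)
    · rw [Ideal.span_le, Set.singleton_subset_iff]
      exact hgI
  · refine ⟨0, le_antisymm (fun p hp => ?_) (by simp)⟩
    by_contra hp0
    obtain ⟨d, h0, hd⟩ := exists_top_coeffOf (p := p) (by simpa using hp0)
    exact hI ⟨d, p, hp, h0, hd⟩

/-! ### Coefficient vectors as representatives modulo `f`. -/

/-- The skew polynomial `∑ cᵢ Xⁱ` with coefficient vector `c`. -/
def vecPoly (θ : RingAut F) {n : ℕ} (c : Fin n → F) : SkewRing θ := ∑ i : Fin n, mono θ i (c i)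

theorem vecPoly_add {n : ℕ} (c d : Fin n → F) :
    vecPoly θ (c + d) = vecPoly θ c + vecPoly θ d := by
  simp [vecPoly, mono_add, Finset.sum_add_distrib]

theorem vecPoly_smul {n : ℕ} (t : F) (c : Fin n → F) :
    vecPoly θ (t • c) = mono θ 0 t * vecPoly θ c := by
  simp [vecPoly, Finset.mul_sum, mono_mul_mono]

theorem vecPoly_zero {n : ℕ} : vecPoly θ (0 : Fin n → F) = 0 := by
  simp [vecPoly, mono_zero]

theorem vecPoly_sum {n : ℕ} {ι : Type*} (s : Finset ι) (c : ι → Fin n → F) :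
    vecPoly θ (∑ k ∈ s, c k) = ∑ k ∈ s, vecPoly θ (c k) := by
  classical
  induction s using Finset.induction_on with
  | empty => simp [vecPoly_zero]
  | insert k s hk ih => rw [Finset.sum_insert hk, Finset.sum_insert hk, vecPoly_add, ih]

theorem coeffOf_vecPoly {n : ℕ} (c : Fin n → F) (i : Fin n) : coeffOf (vecPoly θ c) i = c i := by
  rw [vecPoly, coeffOf_sum]
  simp [coeffOf_mono, Fin.val_inj]

theorem degLT_vecPoly {n : ℕ} (c : Fin n → F) : DegLT (vecPoly θ c) n := by
  intro i hi
  rw [vecPoly, coeffOf_sum]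
  exact Finset.sum_eq_zero fun k _ => by rw [coeffOf_mono, if_neg (by omega)]

theorem DegLT.vecPoly_coeffOf {p : SkewRing θ} {n : ℕ} (hp : DegLT p n) :
    vecPoly θ (fun i : Fin n => coeffOf p i) = p := hp.eq_sum.symm

theorem vecPoly_injective {n : ℕ} : Function.Injective (vecPoly θ : (Fin n → F) → SkewRing θ) :=
  fun c d h => funext fun i => by rw [← coeffOf_vecPoly (θ := θ) c, h, coeffOf_vecPoly]

theorem skewChar_eq {n : ℕ} (a : Fin n → F) :
    skewChar θ a = indet θ ^ n - vecPoly θ a ∨ skewChar θ a = -(indet θ ^ n - vecPoly θ a) := by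
  rcases neg_one_pow_eq_or (SkewRing θ) n with h | h
  · left; rw [skewChar, h, one_mul]; rfl
  · right; rw [skewChar, h, neg_one_mul]; rfl

/-- The sign `(-1) ^ n` is a unit, so reduction modulo `f` can use the monic polynomial. -/
theorem span_skewChar {n : ℕ} (a : Fin n → F) :
    (Ideal.span {skewChar θ a} : Ideal (SkewRing θ)) =
      Ideal.span {indet θ ^ n - vecPoly θ a} := by
  rcases skewChar_eq (θ := θ) a with h | h
  · rw [h]
  · ext p
    simp only [h, Ideal.mem_span_singleton']
    constructor
    · rintro ⟨u, rfl⟩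
      exact ⟨-u, neg_mul_comm _ _⟩
    · rintro ⟨u, rfl⟩
      exact ⟨-u, neg_mul_neg _ _⟩

theorem degLT_skewChar {n : ℕ} (a : Fin n → F) : DegLT (skewChar θ a) (n + 1) := by
  have h : DegLT (indet θ ^ n - vecPoly θ a) (n + 1) := by
    intro i hi
    rw [coeffOf_sub, ← mono_one, coeffOf_mono, degLT_vecPoly a i (by omega), if_neg (by omega),
      sub_zero]
  rcases skewChar_eq (θ := θ) a with h' | h' <;> rw [h']
  · exact h
  · exact fun i hi => by rw [coeffOf_neg, h i hi, neg_zero]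

theorem coeffOf_skewChar_ne_zero {n : ℕ} (a : Fin n → F) : coeffOf (skewChar θ a) n ≠ 0 := by
  have h : coeffOf (indet θ ^ n - vecPoly θ a) n = 1 := by
    rw [coeffOf_sub, ← mono_one, coeffOf_mono, degLT_vecPoly a n le_rfl, if_pos rfl, sub_zero]
  rcases skewChar_eq (θ := θ) a with h' | h' <;> rw [h']
  · rw [h]; exact one_ne_zero
  · rw [coeffOf_neg, h]; exact neg_ne_zero.2 one_ne_zero

/-- A nonzero left multiple of `f` has degree at least `n`, because degrees add. -/
theorem DegLT.eq_zero_of_mem_span_skewChar {n : ℕ} {a : Fin n → F} {p : SkewRing θ}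
    (hp : DegLT p n) (h : p ∈ Ideal.span {skewChar θ a}) : p = 0 := by
  obtain ⟨u, rfl⟩ := Ideal.mem_span_singleton'.1 h
  by_contra hu
  obtain ⟨d, hd0, hd⟩ := exists_top_coeffOf (p := u) (fun h => hu (by rw [h, zero_mul]))
  refine mul_ne_zero hd0 ((map_ne_zero (θ ^ d)).2 (coeffOf_skewChar_ne_zero (θ := θ) a)) ?_
  rw [← coeffOf_mul_top hd (degLT_skewChar a)]
  exact hp _ (by omega)

theorem polyRep_injective {n : ℕ} (a : Fin n → F) :
    Function.Injective (polyRep θ (skewChar θ a) : (Fin n → F) → _) := by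
  intro c d h
  have hmem : vecPoly θ c - vecPoly θ d ∈ Ideal.span {skewChar θ a} :=
    (Submodule.Quotient.eq _).1 h
  exact vecPoly_injective (sub_eq_zero.1
    (((degLT_vecPoly c).sub (degLT_vecPoly d)).eq_zero_of_mem_span_skewChar hmem))

/-- The companion matrix describes left multiplication by `X` modulo `f`. -/
theorem indet_mul_vecPoly_sub_mem {n : ℕ} (a : Fin n → F) (c : Fin n → F) :
    indet θ * vecPoly θ c - vecPoly θ (semilin θ (companion a) c) ∈
      (Ideal.span {skewChar θ a} : Ideal (SkewRing θ)) := by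
  rw [span_skewChar]
  cases n with
  | zero =>
    rw [Subsingleton.elim c 0, map_zero, vecPoly_zero, mul_zero, sub_zero]
    exact zero_mem _
  | succ n =>
    -- The only term of `X * c` in degree `n + 1` is `θ(c_n) X ^ (n + 1)`; subtracting this multiple
    -- of the monic polynomial replaces it by `θ(c_n) a`.
    refine Ideal.mem_span_singleton'.2 ⟨mono θ 0 (θ (c (Fin.last n))), ?_⟩
    have hs : semilin θ (companion a) c =
        (∑ i : Fin n, θ (c i.castSucc) • Pi.single i.succ 1) + θ (c (Fin.last n)) • a := by
      ext k
      change ∑ i, θ (c i) * companion a i k = _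
      rw [Fin.sum_univ_castSucc, Pi.add_apply, Finset.sum_apply]
      congr 1
      · refine Finset.sum_congr rfl fun i _ => ?_
        have h1 : (i : ℕ) ≠ n := i.2.ne
        simp [companion, h1, Pi.single_apply, Fin.ext_iff]
      · simp [companion]
    have hX : indet θ * vecPoly θ c = (∑ i : Fin n, mono θ (i + 1) (θ (c i.castSucc))) +
        mono θ 0 (θ (c (Fin.last n))) * indet θ ^ (n + 1) := by
      rw [vecPoly, Finset.mul_sum, Fin.sum_univ_castSucc]
      simp only [indet_mul_mono, Fin.val_castSucc, Fin.val_last]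
      rw [← mono_eq_mul_indet_pow]
    have hsingle : ∀ i : Fin n, vecPoly θ (Pi.single i.succ 1 : Fin (n + 1) → F) =
        indet θ ^ ((i : ℕ) + 1) := by
      intro i
      rw [vecPoly, Finset.sum_eq_single i.succ, Pi.single_eq_same, mono_one, Fin.val_succ]
      · intro k _ hk
        rw [Pi.single_eq_of_ne hk, mono_zero]
      · simp
    rw [hs, hX, vecPoly_add, vecPoly_sum]
    simp only [vecPoly_smul, hsingle, ← mono_eq_mul_indet_pow, mul_sub]
    abel

theorem polyRep_semilin_companion {n : ℕ} (a : Fin n → F) (c : Fin n → F) :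
    polyRep θ (skewChar θ a) (semilin θ (companion a) c) =
      indet θ • polyRep θ (skewChar θ a) c :=
  ((Submodule.Quotient.eq _).2 (indet_mul_vecPoly_sub_mem a c)).symm

theorem polyRep_add (f : SkewRing θ) {n : ℕ} (c d : Fin n → F) :
    polyRep θ f (c + d) = polyRep θ f c + polyRep θ f d :=
  congrArg (Submodule.mkQ _) (vecPoly_add c d)

theorem polyRep_smul (f : SkewRing θ) {n : ℕ} (t : F) (c : Fin n → F) :
    polyRep θ f (t • c) = mono θ 0 t • polyRep θ f c :=
  congrArg (Submodule.mkQ _) (vecPoly_smul t c)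

theorem polyRep_zero (f : SkewRing θ) {n : ℕ} : polyRep θ f (0 : Fin n → F) = 0 :=
  congrArg (Submodule.mkQ _) vecPoly_zero

/-! ### Module codes as invariant codes. -/

/-- The left submodule of `R/Rf` attached to a code invariant under `Θ ∘ companion a`. -/
def codeSubmodule {n : ℕ} {a : Fin n → F} {𝒟 : Submodule F (Fin n → F)}
    (h : IsTCode θ (companion a) 𝒟) :
    Submodule (SkewRing θ) (SkewRing θ ⧸ Ideal.span {skewChar θ a}) where
  carrier := polyRep θ (skewChar θ a) '' (𝒟 : Set (Fin n → F))
  zero_mem' := ⟨0, 𝒟.zero_mem, polyRep_zero _⟩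
  add_mem' := by
    rintro _ _ ⟨c, hc, rfl⟩ ⟨d, hd, rfl⟩
    exact ⟨c + d, 𝒟.add_mem hc hd, polyRep_add _ c d⟩
  smul_mem' := by
    intro p x hx
    have hpow : ∀ (i : ℕ) x, x ∈ polyRep θ (skewChar θ a) '' (𝒟 : Set (Fin n → F)) →
        indet θ ^ i • x ∈ polyRep θ (skewChar θ a) '' (𝒟 : Set (Fin n → F)) := by
      intro i
      induction i with
      | zero => intro x hx; rwa [pow_zero, one_smul]
      | succ i ih =>
        rintro _ ⟨c, hc, rfl⟩
        rw [pow_succ, mul_smul, ← polyRep_semilin_companion]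
        exact ih _ ⟨_, h c hc, rfl⟩
    induction p using induction_mono with
    | h0 => rw [zero_smul]; exact ⟨0, 𝒟.zero_mem, polyRep_zero _⟩
    | h i t q ih =>
      obtain ⟨c, hc, hcx⟩ := hpow i x hx
      obtain ⟨d, hd, hdx⟩ := ih
      rw [add_smul, mono_eq_mul_indet_pow, mul_smul, ← hcx, ← hdx]
      exact ⟨t • c + d, 𝒟.add_mem (𝒟.smul_mem t hc) hd, by rw [polyRep_add, polyRep_smul]⟩

/-- Module codes are exactly the codes invariant under `Θ ∘ companion a`. -/
theorem isModuleCode_iff_isTCode {n : ℕ} (a : Fin n → F) (𝒟 : Submodule F (Fin n → F)) :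
    IsModuleCode θ a 𝒟 ↔ IsTCode θ (companion a) 𝒟 := by
  constructor
  · rintro ⟨g, -, hg⟩ v hv
    have hmem : polyRep θ (skewChar θ a) (semilin θ (companion a) v) ∈
        polyRep θ (skewChar θ a) '' (𝒟 : Set (Fin n → F)) := by
      rw [hg, polyRep_semilin_companion]
      refine Submodule.smul_mem _ _ ?_
      rw [← SetLike.mem_coe, ← hg]
      exact ⟨v, hv, rfl⟩
    obtain ⟨w, hw, hwv⟩ := hmem
    rwa [← polyRep_injective a hwv]
  · intro h
    obtain ⟨g, hg⟩ := exists_eq_span_singleton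
      (Submodule.comap (Submodule.mkQ (Ideal.span {skewChar θ a})) (codeSubmodule h))
    refine ⟨g, ?_, ?_⟩
    · have hf : skewChar θ a ∈ Submodule.comap (Submodule.mkQ (Ideal.span {skewChar θ a}))
          (codeSubmodule h) := by
        rw [Submodule.mem_comap, Submodule.mkQ_apply,
          (Submodule.Quotient.mk_eq_zero _).2 (Ideal.mem_span_singleton_self _)]
        exact zero_mem _
      rw [hg] at hf
      obtain ⟨u, hu⟩ := Ideal.mem_span_singleton'.1 hf
      exact ⟨u, hu.symm⟩
    · rw [← hg, Submodule.map_comap_eq_of_surjective (Submodule.mkQ_surjective _)]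
      rfl

end SkewPolynomials

/-! ### Invariance of dual codes under semi-linear isometries. -/

section Duality

variable {F : Type*} [Field F] {θ : RingAut F}

theorem semilin_apply {ι : Type*} [Fintype ι] (A : Matrix ι ι F) (v : ι → F) :
    semilin θ A v = (fun i => θ (v i)) ᵥ* A := rfl

theorem dotProduct_vecMul_mul_transpose {ι κ : Type*} [Fintype ι] [Fintype κ]
    (Q : Matrix ι κ F) (x y : ι → F) :
    (x ᵥ* (Q * Qᵀ)) ⬝ᵥ y = (x ᵥ* Q) ⬝ᵥ (y ᵥ* Q) := by
  rw [← vecMul_vecMul, ← dotProduct_mulVec, mulVec_transpose]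

/-- The orthogonal matrix preserves the dot product, and `Θ` applies `θ` to its value; orthogonality
of vectors is therefore kept. -/
theorem semilin_dotProduct_semilin {κ : Type*} [Fintype κ] [DecidableEq κ]
    {P : Matrix κ κ F} (hP : P * Pᵀ = 1) (v w : κ → F) :
    semilin θ P v ⬝ᵥ semilin θ P w = θ (v ⬝ᵥ w) := by
  rw [semilin_apply, semilin_apply, ← dotProduct_vecMul_mul_transpose, hP, vecMul_one]
  simp [dotProduct]

theorem semilin_injective {κ : Type*} [Fintype κ] [DecidableEq κ]
    {P : Matrix κ κ F} (hP : P * Pᵀ = 1) : Function.Injective (semilin θ P) := by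
  intro v w h
  have h' : semilin θ P v ᵥ* Pᵀ = semilin θ P w ᵥ* Pᵀ := congrArg (· ᵥ* Pᵀ) h
  rw [semilin_apply, semilin_apply, vecMul_vecMul, vecMul_vecMul, hP, vecMul_one,
    vecMul_one] at h'
  exact funext fun i => θ.injective (congrFun h' i)

/-- If `Q` intertwines `Θ ∘ A` with `Θ ∘ P` for an orthogonal matrix `P`, then the dual of a
`Θ ∘ A`-invariant code for the form `x Q Qᵗ yᵗ` is `Θ ∘ A`-invariant. -/
theorem IsTCode.dualCode_of_intertwines [Finite F] {ι κ : Type*} [Fintype ι] [Fintype κ]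
    [DecidableEq κ] {A : Matrix ι ι F} {P : Matrix κ κ F} {Q : Matrix ι κ F} (hP : P * Pᵀ = 1)
    (hQ : ∀ v, semilin θ A v ᵥ* Q = semilin θ P (v ᵥ* Q)) {𝒟 : Submodule F (ι → F)}
    (h𝒟 : IsTCode θ A 𝒟) : IsTCode θ A (dualCode (Q * Qᵀ) 𝒟) := by
  intro x hx c hc
  have hmaps : Set.MapsTo (semilin θ P) ((· ᵥ* Q) '' (𝒟 : Set (ι → F)))
      ((· ᵥ* Q) '' (𝒟 : Set (ι → F))) := by
    rintro _ ⟨d, hd, rfl⟩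
    exact ⟨_, h𝒟 d hd, hQ d⟩
  -- Isometry only controls products with vectors in the image of `Θ ∘ P`. An injective self-map of
  -- a finite set is onto, so every `c Q` is such an image.
  have hsurj : Set.SurjOn (semilin θ P) ((· ᵥ* Q) '' (𝒟 : Set (ι → F)))
      ((· ᵥ* Q) '' (𝒟 : Set (ι → F))) :=
    ((Set.toFinite _).injOn_iff_bijOn_of_mapsTo hmaps).1 (semilin_injective hP).injOn |>.surjOn
  obtain ⟨_, ⟨d, hd, rfl⟩, hdc⟩ := hsurj ⟨c, hc, rfl⟩
  have hxd : (x ᵥ* (Q * Qᵀ)) ⬝ᵥ d = 0 := hx d hd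
  rw [dotProduct_vecMul_mul_transpose] at hxd ⊢
  change semilin θ P (d ᵥ* Q) = c ᵥ* Q at hdc
  rw [hQ, ← hdc, semilin_dotProduct_semilin hP, hxd, map_zero]

/-- Nondegeneracy of the dot product; it reduces each statement on kernels to one on duals. -/
theorem kerCode_eq_dualCode_top {ι : Type*} [Fintype ι] (B : Matrix ι ι F) :
    kerCode B = dualCode B ⊤ := by
  ext x
  change x ᵥ* B = 0 ↔ ∀ c ∈ (⊤ : Submodule F (ι → F)), (x ᵥ* B) ⬝ᵥ c = 0
  constructor
  · intro h c _
    rw [h, zero_dotProduct]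
  · exact fun h => dotProduct_eq_zero _ fun c => h c trivial

theorem IsTCode.sup {ι : Type*} [Fintype ι] {A : Matrix ι ι F} {𝒟 ℰ : Submodule F (ι → F)}
    (h𝒟 : IsTCode θ A 𝒟) (hℰ : IsTCode θ A ℰ) : IsTCode θ A (𝒟 ⊔ ℰ) := by
  intro v hv
  obtain ⟨d, hd, e, he, rfl⟩ := Submodule.mem_sup.1 hv
  rw [map_add]
  exact Submodule.add_mem_sup (h𝒟 d hd) (hℰ e he)

end Duality

/-! ### The matrix `Q` as right multiplication by `q_f`. -/

section Embedding

variable {F : Type*} [Field F] {θ : RingAut F}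

/-- The shift is the permutation matrix of `finRotate`. -/
theorem shiftMatrix_mul_transpose (m : ℕ) : shiftMatrix F m * (shiftMatrix F m)ᵀ = 1 := by
  cases m with
  | zero => exact Subsingleton.elim _ _
  | succ m =>
    have h : shiftMatrix F (m + 1) = (finRotate (m + 1)).toPEquiv.toMatrix := by
      ext i k
      rw [PEquiv.toMatrix_apply, Equiv.toPEquiv_apply]
      simp only [shiftMatrix, companion, of_apply, Option.mem_def, Option.some.injEq]
      rcases Fin.eq_castSucc_or_eq_last i with ⟨i, rfl⟩ | rfl
      · have h1 : (i : ℕ) ≠ m := i.2.ne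
        rw [finRotate_apply, Fin.coeSucc_eq_succ, Fin.val_castSucc, if_neg (by omega)]
        exact if_congr (by rw [Fin.ext_iff, Fin.val_succ, eq_comm]) rfl rfl
      · rw [finRotate_last, Fin.val_last, if_pos rfl]
        exact if_congr (by rw [Fin.ext_iff, Fin.val_zero, eq_comm]) rfl rfl
    rw [h, ← PEquiv.toMatrix_symm, ← PEquiv.toMatrix_trans, ← Equiv.toPEquiv_symm,
      ← Equiv.toPEquiv_trans, Equiv.self_trans_symm, Equiv.toPEquiv_refl, PEquiv.toMatrix_refl]

/-- The shift is itself a companion matrix; this identifies its skew polynomial as `X ^ m - 1` up to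
sign. -/
theorem vecPoly_pi_zero {m : ℕ} (hm : 0 < m) :
    vecPoly θ (fun k : Fin m => if (k : ℕ) = 0 then (1 : F) else 0) = 1 := by
  rw [vecPoly, Finset.sum_eq_single ⟨0, hm⟩]
  · simp [mono_one]
  · intro k _ hk
    rw [if_neg fun h => hk (Fin.ext h), mono_zero]
  · simp

/-- Degrees add and `n > 0`, so `q` has degree below `m`: its vector of `m` coefficients loses
nothing. -/
theorem degLT_of_eq_skewChar_mul {n m : ℕ} (hn : 0 < n) (a : Fin n → F) {q : SkewRing θ}
    (h : indet θ ^ m - 1 = skewChar θ a * q) : DegLT q m := by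
  by_cases hq : q = 0
  · rw [hq]; exact fun _ _ => rfl
  obtain ⟨d, hd0, hd⟩ := exists_top_coeffOf hq
  by_cases hdm : d < m
  · exact fun i hi => hd i (by omega)
  exfalso
  have htop := coeffOf_mul_top (degLT_skewChar (θ := θ) a) hd
  rw [← h, coeffOf_sub, ← mono_one, ← pow_zero (indet θ), ← mono_one, coeffOf_mono,
    coeffOf_mono, if_neg (by omega), if_neg (by omega), sub_zero] at htop
  exact mul_ne_zero (coeffOf_skewChar_ne_zero a) ((map_ne_zero (θ ^ n)).2 hd0) htop.symm

theorem cofactor_spec {n : ℕ} (a : Fin n → F) (h : period θ a ≠ 0) :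
    indet θ ^ period θ a - 1 = skewChar θ a * cofactor θ a := by
  -- `sInf ∅ = 0` in `ℕ`, so a nonzero period certifies that a suitable exponent exists.
  have hne : {m : ℕ | n ≤ m ∧ skewChar θ a ∣ indet θ ^ m - 1}.Nonempty := by
    by_contra hne
    rw [Set.not_nonempty_iff_eq_empty] at hne
    exact h (by rw [period, hne, Nat.sInf_empty])
  have hex : ∃ q, indet θ ^ period θ a - 1 = skewChar θ a * q := (Nat.sInf_mem hne).2
  rw [cofactor, dif_pos hex]
  exact hex.choose_spec

/-- Right multiplication by `q_f` carries left multiplication by `X` modulo `f` to left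
multiplication by `X` modulo `X ^ m - 1`; on coefficient vectors, `Q` intertwines the two
semi-linear maps. -/
theorem semilin_vecMul_embMatrix {n : ℕ} (hn : 0 < n) (a : Fin n → F) (v : Fin n → F) :
    semilin θ (companion a) v ᵥ* embMatrix θ a =
      semilin θ (shiftMatrix F (period θ a)) (v ᵥ* embMatrix θ a) := by
  -- With period `0` the target space is trivial, so existence of a suitable exponent need not be
  -- proved.
  by_cases hm : period θ a = 0
  · have : IsEmpty (Fin (period θ a)) := by rw [hm]; infer_instance
    exact Subsingleton.elim _ _
  have hq := cofactor_spec a hm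
  have hdeg := degLT_of_eq_skewChar_mul hn a hq
  simp only [embMatrix] at *
  generalize cofactor θ a = q at *
  generalize period θ a = m at *
  set e : Fin m → F := fun k => if (k : ℕ) = 0 then 1 else 0 with he
  have hspan : (Ideal.span {skewChar θ e} : Ideal (SkewRing θ)) =
      Ideal.span {indet θ ^ m - 1} := by
    rw [span_skewChar, vecPoly_pi_zero (Nat.pos_of_ne_zero hm)]
  -- Row `k` of `Q` represents `X ^ k * q` modulo `X ^ m - 1`; by linearity `x Q` represents `x(X) *
  -- q`.
  have hiter : ∀ k : ℕ, polyRep θ (skewChar θ e)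
      ((semilin θ (shiftMatrix F m))^[k] fun i => coeffOf q i) =
        Submodule.Quotient.mk (indet θ ^ k * q) := by
    intro k
    induction k with
    | zero =>
      rw [pow_zero, one_mul]
      exact congrArg (Submodule.mkQ _) hdeg.vecPoly_coeffOf
    | succ k ih =>
      rw [Function.iterate_succ_apply']
      change polyRep θ (skewChar θ e) (semilin θ (companion e) _) = _
      rw [polyRep_semilin_companion, ih, pow_succ', mul_assoc]
      rfl
  have hrep : ∀ x : Fin n → F, polyRep θ (skewChar θ e) (x ᵥ* Matrix.of fun k : Fin n =>
      (semilin θ (shiftMatrix F m))^[(k : ℕ)] fun i => coeffOf q i) =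
        Submodule.Quotient.mk (vecPoly θ x * q) := by
    intro x
    rw [vecMul_eq_sum]
    change Submodule.mkQ _ (vecPoly θ _) = Submodule.mkQ _ (vecPoly θ x * q)
    rw [vecPoly_sum, map_sum, vecPoly, Finset.sum_mul, map_sum]
    refine Finset.sum_congr rfl fun k _ => ?_
    rw [mono_eq_mul_indet_pow, mul_assoc]
    change polyRep θ (skewChar θ e) _ = mono θ 0 (x k) • Submodule.Quotient.mk _
    rw [← hiter]
    exact polyRep_smul _ _ _
  apply polyRep_injective (θ := θ) e
  change _ = polyRep θ (skewChar θ e) (semilin θ (companion e) _)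
  rw [polyRep_semilin_companion, hrep, hrep]
  refine Eq.symm ((Submodule.Quotient.eq _).2 ?_)
  -- The two sides differ by `u * f` modulo nothing else before multiplication by `q`; afterwards by
  -- `u * f * q = u * (X ^ m - 1)`, which vanishes in the quotient.
  obtain ⟨u, hu⟩ := Ideal.mem_span_singleton'.1 (indet_mul_vecPoly_sub_mem (θ := θ) a v)
  change indet θ * (vecPoly θ v * q) - _ ∈ _
  rw [← mul_assoc, ← sub_mul, ← hu, mul_assoc, ← hq, hspan]
  exact Ideal.mem_span_singleton'.2 ⟨u, rfl⟩

/-- The dual of an `f`-module code for the form `x Q Qᵗ yᵗ` is an `f`-module code. -/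
theorem IsModuleCode.dualCode [Finite F] {n : ℕ} (hn : 0 < n) (a : Fin n → F)
    {𝒟 : Submodule F (Fin n → F)} (h : IsModuleCode θ a 𝒟) :
    IsModuleCode θ a (dualCode (embMatrix θ a * (embMatrix θ a)ᵀ) 𝒟) := by
  rw [isModuleCode_iff_isTCode] at h ⊢
  exact h.dualCode_of_intertwines (shiftMatrix_mul_transpose _) (semilin_vecMul_embMatrix hn a)

theorem isModuleCode_kerCode [Finite F] {n : ℕ} (hn : 0 < n) (a : Fin n → F) :
    IsModuleCode θ a (kerCode (embMatrix θ a * (embMatrix θ a)ᵀ)) := by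
  rw [kerCode_eq_dualCode_top]
  refine IsModuleCode.dualCode hn a ?_
  rw [isModuleCode_iff_isTCode]
  exact fun _ _ => trivial

theorem IsModuleCode.sup {n : ℕ} {a : Fin n → F} {𝒟 ℰ : Submodule F (Fin n → F)}
    (h𝒟 : IsModuleCode θ a 𝒟) (hℰ : IsModuleCode θ a ℰ) : IsModuleCode θ a (𝒟 ⊔ ℰ) := by
  rw [isModuleCode_iff_isTCode] at *
  exact h𝒟.sup hℰ

end Embedding

/-! ### Block decomposition and change of coordinates by `C`. -/

section Products

variable {F : Type*} [Field F] {θ : RingAut F} {r : ℕ} {n : Fin r → ℕ}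

theorem mem_prodCode {𝒟 : ∀ j, Submodule F (Fin (n j) → F)} {x : (Σ j, Fin (n j)) → F} :
    x ∈ prodCode 𝒟 ↔ ∀ j, (fun k => x ⟨j, k⟩) ∈ 𝒟 j := by
  rw [prodCode, Submodule.mem_iInf]
  rfl

theorem vecMul_blockDiagonal'_apply {p : Fin r → ℕ}
    (A : ∀ j, Matrix (Fin (n j)) (Fin (p j)) F) (x : (Σ j, Fin (n j)) → F) (j : Fin r) :
    (fun k => (x ᵥ* blockDiagonal' A) ⟨j, k⟩) = (fun k => x ⟨j, k⟩) ᵥ* A j := by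
  ext k
  simp only [vecMul, dotProduct]
  rw [Fintype.sum_sigma, Finset.sum_eq_single j]
  · simp [blockDiagonal'_apply_eq]
  · intro i _ hij
    simp [blockDiagonal'_apply_ne _ _ _ hij]
  · simp

theorem prodCode_sup (𝒟 ℰ : ∀ j, Submodule F (Fin (n j) → F)) :
    prodCode (fun j => 𝒟 j ⊔ ℰ j) = prodCode 𝒟 ⊔ prodCode ℰ := by
  ext x
  rw [Submodule.mem_sup, mem_prodCode]
  constructor
  · intro h
    choose d hd e he hde using fun j => Submodule.mem_sup.1 (h j)
    refine ⟨fun s => d s.1 s.2, mem_prodCode.2 hd, fun s => e s.1 s.2, mem_prodCode.2 he, ?_⟩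
    exact funext fun s => congrFun (hde s.1) s.2
  · rintro ⟨d, hd, e, he, rfl⟩ j
    exact Submodule.add_mem_sup (mem_prodCode.1 hd j) (mem_prodCode.1 he j)

theorem dualCode_prodCode (A : ∀ j, Matrix (Fin (n j)) (Fin (n j)) F)
    (𝒟 : ∀ j, Submodule F (Fin (n j) → F)) :
    dualCode (blockDiagonal' A) (prodCode 𝒟) = prodCode fun j => dualCode (A j) (𝒟 j) := by
  classical
  have hdot : ∀ x y : (Σ j, Fin (n j)) → F, (x ᵥ* blockDiagonal' A) ⬝ᵥ y =
      ∑ j, ((fun k => x ⟨j, k⟩) ᵥ* A j) ⬝ᵥ fun k => y ⟨j, k⟩ := by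
    intro x y
    simp only [← vecMul_blockDiagonal'_apply]
    exact Fintype.sum_sigma _
  ext x
  rw [mem_prodCode]
  constructor
  · intro hx j c hc
    -- Testing against vectors supported in block `j` isolates the condition on that block.
    let y : (Σ j, Fin (n j)) → F := fun s => Pi.single (M := fun j => Fin (n j) → F) j c s.1 s.2
    have hy : ∀ i, (fun k => y ⟨i, k⟩) = Pi.single (M := fun j => Fin (n j) → F) j c i :=
      fun i => rfl
    have hmem : y ∈ prodCode 𝒟 := mem_prodCode.2 fun i => by
      rw [hy]
      rcases eq_or_ne i j with rfl | hij
      · rwa [Pi.single_eq_same]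
      · rw [Pi.single_eq_of_ne hij]; exact zero_mem _
    have h0 := hx y hmem
    rw [hdot, Finset.sum_eq_single j] at h0
    · rwa [hy, Pi.single_eq_same] at h0
    · intro i _ hij
      rw [hy, Pi.single_eq_of_ne hij, dotProduct_zero]
    · simp
  · intro hx y hy
    rw [hdot]
    exact Finset.sum_eq_zero fun j _ => hx j _ (mem_prodCode.1 hy j)

theorem prodCode_top : prodCode (fun j => (⊤ : Submodule F (Fin (n j) → F))) = ⊤ := by
  ext x; simp [mem_prodCode]

theorem kerCode_blockDiagonal' (A : ∀ j, Matrix (Fin (n j)) (Fin (n j)) F) :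
    kerCode (blockDiagonal' A) = prodCode fun j => kerCode (A j) := by
  simp only [kerCode_eq_dualCode_top]
  rw [← dualCode_prodCode, prodCode_top]

theorem vecMul_inv_vecMul {ι : Type*} [Fintype ι] [DecidableEq ι] {C : Matrix ι ι F}
    (hC : IsUnit C) (v : ι → F) : v ᵥ* C⁻¹ ᵥ* C = v := by
  rw [vecMul_vecMul, nonsing_inv_mul _ ((isUnit_iff_isUnit_det C).1 hC), vecMul_one]

theorem vecMul_vecMul_inv {ι : Type*} [Fintype ι] [DecidableEq ι] {C : Matrix ι ι F}
    (hC : IsUnit C) (v : ι → F) : v ᵥ* C ᵥ* C⁻¹ = v := by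
  rw [vecMul_vecMul, mul_nonsing_inv _ ((isUnit_iff_isUnit_det C).1 hC), vecMul_one]

/-- Transport of a dual code along an invertible change of coordinates. -/
theorem dualCode_map {ι : Type*} [Fintype ι] [DecidableEq ι] {C : Matrix ι ι F} (hC : IsUnit C)
    (G : Matrix ι ι F) (𝒟 : Submodule F (ι → F)) :
    dualCode (C⁻¹ * G * (C⁻¹)ᵀ) (𝒟.map C.vecMulLinear) =
      (dualCode G 𝒟).map C.vecMulLinear := by
  have hdot : ∀ x y : ι → F, (x ᵥ* (C⁻¹ * G * (C⁻¹)ᵀ)) ⬝ᵥ y =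
      (x ᵥ* C⁻¹ ᵥ* G) ⬝ᵥ (y ᵥ* C⁻¹) := by
    intro x y
    rw [← vecMul_vecMul, ← vecMul_vecMul, ← dotProduct_mulVec, mulVec_transpose]
  ext x
  constructor
  · intro hx
    refine ⟨x ᵥ* C⁻¹, fun d hd => ?_, vecMul_inv_vecMul hC x⟩
    have h0 := hx (d ᵥ* C) ⟨d, hd, rfl⟩
    rwa [hdot, vecMul_vecMul_inv hC] at h0
  · rintro ⟨y, hy, rfl⟩ _ ⟨d, hd, rfl⟩
    rw [hdot]
    change (y ᵥ* C ᵥ* C⁻¹ ᵥ* G) ⬝ᵥ (d ᵥ* C ᵥ* C⁻¹) = 0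
    rw [vecMul_vecMul_inv hC, vecMul_vecMul_inv hC]
    exact hy d hd

/-- The invertible `C` maps the whole space onto itself, so this is `dualCode_map` at `⊤`. -/
theorem kerCode_conj {ι : Type*} [Fintype ι] [DecidableEq ι] {C : Matrix ι ι F} (hC : IsUnit C)
    (G : Matrix ι ι F) :
    kerCode (C⁻¹ * G * (C⁻¹)ᵀ) = (kerCode G).map C.vecMulLinear := by
  have htop : (⊤ : Submodule F (ι → F)).map C.vecMulLinear = ⊤ := by
    rw [Submodule.map_top, LinearMap.range_eq_top]
    exact fun x => ⟨x ᵥ* C⁻¹, vecMul_inv_vecMul hC x⟩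
  rw [kerCode_eq_dualCode_top, kerCode_eq_dualCode_top, ← dualCode_map hC, htop]

theorem formMatrix_eq (a : ∀ j, Fin (n j) → F)
    (C : Matrix (Σ j, Fin (n j)) (Σ j, Fin (n j)) F) :
    formMatrix θ a C = C⁻¹ *
      blockDiagonal' (fun j => embMatrix θ (a j) * (embMatrix θ (a j))ᵀ) * (C⁻¹)ᵀ := by
  rw [formMatrix, embBlock, blockDiagonal'_transpose, blockDiagonal'_mul, Matrix.mul_assoc C⁻¹]

/-- The invariance under `T` is automatic for a product of module codes. -/
theorem HypStar.isProductTCode {a : ∀ j, Fin (n j) → F}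
    {M C : Matrix (Σ j, Fin (n j)) (Σ j, Fin (n j)) F} (hT : HypStar θ n a M C)
    {𝒟 : ∀ j, Submodule F (Fin (n j) → F)} (h : ∀ j, IsModuleCode θ (a j) (𝒟 j)) :
    IsProductTCode θ a M C ((prodCode 𝒟).map C.vecMulLinear) := by
  refine ⟨?_, 𝒟, h, rfl⟩
  rintro _ ⟨d, hd, rfl⟩
  -- On `d C` the factor `C⁻¹` of `T` cancels, leaving `(d D) C` with `D` acting block by block.
  rw [hT.similar]
  refine ⟨_, mem_prodCode.2 fun j => ?_, rfl⟩
  change (fun k => semilin θ _ (d ᵥ* C ᵥ* C⁻¹) ⟨j, k⟩) ∈ 𝒟 j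
  rw [vecMul_vecMul_inv hT.invertible, semilin_apply, vecMul_blockDiagonal'_apply]
  exact (isModuleCode_iff_isTCode _ _).1 (h j) _ (mem_prodCode.1 hd j)

/-- The quasi-Euclidean dual of a product `T`-code is a product `T`-code. -/
theorem HypStar.isProductTCode_dualCode [Finite F] {a : ∀ j, Fin (n j) → F}
    {M C : Matrix (Σ j, Fin (n j)) (Σ j, Fin (n j)) F} (hT : HypStar θ n a M C)
    {𝒞 : Submodule F ((Σ j, Fin (n j)) → F)} (h𝒞 : IsProductTCode θ a M C 𝒞) :
    IsProductTCode θ a M C (dualCode (formMatrix θ a C) 𝒞) := by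
  obtain ⟨-, 𝒟, h𝒟, rfl⟩ := h𝒞
  rw [formMatrix_eq, dualCode_map hT.invertible, dualCode_prodCode]
  exact hT.isProductTCode fun j => (h𝒟 j).dualCode (hT.pos j) (a j)

/-- The sum of a product `T`-code and `Ker B` is a product `T`-code. -/
theorem HypStar.isProductTCode_sup_kerCode [Finite F] {a : ∀ j, Fin (n j) → F}
    {M C : Matrix (Σ j, Fin (n j)) (Σ j, Fin (n j)) F} (hT : HypStar θ n a M C)
    {𝒞 : Submodule F ((Σ j, Fin (n j)) → F)} (h𝒞 : IsProductTCode θ a M C 𝒞) :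
    IsProductTCode θ a M C (𝒞 ⊔ kerCode (formMatrix θ a C)) := by
  obtain ⟨-, 𝒟, h𝒟, rfl⟩ := h𝒞
  rw [formMatrix_eq, kerCode_conj hT.invertible, kerCode_blockDiagonal', ← Submodule.map_sup,
    ← prodCode_sup]
  exact hT.isProductTCode fun j => (h𝒟 j).sup (isModuleCode_kerCode (hT.pos j) (a j))

end Products

end SemilinearCode

end

open SemilinearCode in
theorem corollary3p21 {F : Type*} [Field F] [Finite F] (θ : RingAut F)
    {r : ℕ} (n : Fin r → ℕ) (a : ∀ j, Fin (n j) → F)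
    (M C : Matrix (Σ j, Fin (n j)) (Σ j, Fin (n j)) F)
    (hT : HypStar θ n a M C)
    (hdd : ∀ j, orderOf θ ∣ period θ (a j))
    (𝒞 : Submodule F ((Σ j, Fin (n j)) → F))
    (h𝒞 : IsProductTCode θ a M C 𝒞) :
    IsProductTCode θ a M C (dualCode (formMatrix θ a C) 𝒞) ↔
      IsProductTCode θ a M C (𝒞 ⊔ kerCode (formMatrix θ a C)) :=
  ⟨fun _ => hT.isProductTCode_sup_kerCode h𝒞, fun _ => hT.isProductTCode_dualCode h𝒞⟩
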